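/- **Setting.** Addresses are words over $\omega$; two addresses are *disjoint* if neither is a prefix of the other. A base $\vdash\Gamma$ or $\zeta\vdash\Lambda$ ($\Gamma,\Lambda$ finite sets of addresses) is well formed if its addresses are pairwise disjoint. Write $\xi\star J=\{\xi j\mid j\in J\}$. Pseudo-designs are the possibly infinite terms $$\varphi::=\Omega\mid\maltese\mid(+,\xi,I)\cdot\{\psi_{\xi i}\mid i\in I\},\qquad \psi_\zeta::=\{(-,\zeta,J)\varphi_J\mid J\in\mathcal P_f(\omega)\}\qquad (I\in\mathcal P_f(\omega)).$$ Typing (read coinductively): for well-formed bases, $\Omega:(\vdash\Gamma)$ and $\maltese:(\vdash\Gamma)$; $(+,\xi,I)\cdot\{\psi_{\xi i}\}:(\vdash\xi,\Lambda)$ if $\psi_{\xi i}:(\xi i\vdash\Lambda_i)$ with pairwise disjoint $\Lambda_i\subseteq\Lambda$; and $\psi_\zeta:(\zeta\vdash\Lambda)$ if for every $J$, $\varphi_J:(\vdash\zeta\star J,\Lambda_J)$ for some $\Lambda_J\subseteq\Lambda$. Designs are typable pseudo-designs; the positive design $\Omega$ is called partial. $\varphi\subseteq\varphi'$ (likewise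 for negatives) means that $\varphi'$ is obtained from $\varphi$ by replacing occurrences of $\Omega$ by arbitrary trees. The chronicles of a pseudo-design are the sequences of actions along its branches from the root to a node labelled $\maltese$ or by some $(+,\xi,I)$. Normalization is the machine on states $\langle\varphi\mid\Psi\rangle_q$, where $\Psi$ is a set of negative pseudo-designs with distinct indices (it *accepts* $\zeta$ if it contains some $\psi_\zeta$; $\Psi_{\zeta,J}$ is then the branch $\varphi_J$ of $\psi_\zeta$), with $$\text{(R)}\ \langle(+,\xi,I)\cdot\Psi'\mid\Psi\rangle_q\to\langle\Psi_{\xi,I}\mid\Psi'\cup(\Psi\setminus\xi)\rangle_q\ \text{ if }\Psi\text{ accepts }\xi,$$ $$\text{(S)}\ \langle(+,\xi,I)\cdot\Psi'\mid\Psi\rangle_q\to\langle\Psi'_{\xi i,J}\mid\Psi\rangle_{q(+,\xi,I)(-,\xi i,J)}\ \text{ if }\Psi\text{ does not accept }\xi\ (i\in I,\ J\in\mathcal P_f(\omega)).$$ The normal form $[\![\varphi,\psi]\!]$ consists of the following sequences, for the states reachable from $\langle\varphi\mid\{\psi\}\rangle_\epsilon$: $q(+,\xi,I)$ for each reachable $\langle(+,\xi,I)\cdot\Psi'\mid\Psi\rangle_q$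 with $\xi$ not accepted by $\Psi$; $q\,\maltese$ for each reachable $\langle\maltese\mid\Psi\rangle_q$; $q\,\Omega$ for each reachable $\langle\Omega\mid\Psi\rangle_q$, and for each $q$ at which a reachable state starts an infinite sequence of (R) steps. As a set of chronicles in the sense above, $[\![\varphi,\psi]\!]^\bullet$, it is taken without the sequences $q\,\Omega$. For $\varphi:(\vdash\xi)$, $\psi:(\xi\vdash)$, $\varphi\perp\psi$ means $[\![\varphi,\psi]\!]=\{\maltese\}$. **Theorem (Stability).** Let $\varphi:(\vdash\xi,\Lambda_1)$ and $\psi:(\xi\vdash\Lambda_2)$, every address of $\Lambda_1$ being disjoint from every address of $\Lambda_2$. 1. For every $r\in[\![\varphi,\psi]\!]$ there are $\varphi_0\subseteq\varphi$ and $\psi_0\subseteq\psi$, with $\varphi_0:(\vdash\xi,\Lambda_1)$, $\psi_0:(\xi\vdash\Lambda_2)$, and $\varphi_0\neq\Omega$ unless $r=\Omega$, such that $r\in[\![\varphi_0,\psi_0]\!]$, and that are minimum: if $\varphi'\subseteq\varphi$, $\psi'\subseteq\psi$ and $r\in[\![\varphi',\psi']\!]$, then $\varphi_0\subseteq\varphi'$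 and $\psi_0\subseteq\psi'$. 2. Let $(\varphi_k)_k$, $(\psi_k)_k$ be non-empty families with the same index set, $\varphi_k\subseteq\varphi$ and $\psi_k\subseteq\psi$ for all $k$. The set intersections of the $\varphi_k$ and of the $\psi_k$, as sets of chronicles, are (the sets of chronicles of) designs $\bigcap_k\varphi_k:(\vdash\xi,\Lambda_1)$ and $\bigcap_k\psi_k:(\xi\vdash\Lambda_2)$, the former $\neq\Omega$ if all $\varphi_k\ne\Omega$, and $$\Big[\!\!\Big[\bigcap_k\varphi_k,\bigcap_k\psi_k\Big]\!\!\Big]^\bullet=\bigcap_k[\![\varphi_k,\psi_k]\!]^\bullet .$$ If moreover $\Lambda_1=\Lambda_2=\emptyset$, then $\bigcap_k\varphi_k\perp\bigcap_k\psi_k$ if and only if $\varphi_k\perp\psi_k$ for all $k$. -/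

import Mathlib

namespace Ludics

/-- Addresses (loci): words of natural numbers. -/
abbrev Address : Type := List ℕ

/-- The address `ξ i`. -/
def Address.child (ξ : Address) (i : ℕ) : Address := ξ ++ [i]

/-- The set of addresses `ξ ⋆ J = {ξ j | j ∈ J}`. -/
def Address.star (ξ : Address) (J : Finset ℕ) : Finset Address := J.image ξ.child

/-- Two addresses are disjoint if neither is a prefix of the other. -/
def Address.Apart (ξ ζ : Address) : Prop := ¬ ξ <+: ζ ∧ ¬ ζ <+: ξ

/-- Well-formedness of the positive base `⊢ Γ`. -/
def WellFormed (Γ : Finset Address) : Prop :=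
  ∀ ξ ∈ Γ, ∀ ζ ∈ Γ, ξ ≠ ζ → ξ.Apart ζ

/-- Well-formedness of the negative base `ζ ⊢ Λ`. -/
def WellFormedNeg (ζ : Address) (Λ : Finset Address) : Prop :=
  WellFormed Λ ∧ ∀ ξ ∈ Λ, ζ.Apart ξ

/-- The possible roots of a positive pseudo-design: `Ω`, `✠`, or a positive action `(+, ξ, I)`. -/
inductive Root : Type
  | omega : Root
  | daimon : Root
  | act (ξ : Address) (I : Finset ℕ) : Root

/-- Only the root `(+, ξ, I)` has sons; they are indexed by the pairs of an `i ∈ I` and a finite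
set `J` of natural numbers. -/
def Root.Sons : Root → Type
  | .omega => Empty
  | .daimon => Empty
  | .act _ I => {i // i ∈ I} × Finset ℕ

/-- The signature `φ ::= Ω | ✠ | (+, ξ, I) · {{(-, ξ i, J) φ_{i,J}}_J}_i`. -/
def signature : PFunctor.{0, 0} := ⟨Root, Root.Sons⟩

/-- Positive pseudo-designs: the possibly infinite terms over the signature. -/
def PosDesign : Type := signature.M

namespace PosDesign

/-- The pseudo-design `Ω`. -/
def omega : PosDesign := PFunctor.M.mk (F := signature) ⟨Root.omega, Empty.elim⟩

/-- The pseudo-design `✠`. -/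
def daimon : PosDesign := PFunctor.M.mk (F := signature) ⟨Root.daimon, Empty.elim⟩

/-- The pseudo-design `(+, ξ, I) · {ψ_{ξ i} | i ∈ I}` with `ψ_{ξ i} = {(-, ξ i, J) (f i J)}_J`. -/
def act (ξ : Address) (I : Finset ℕ) (f : {i // i ∈ I} → Finset ℕ → PosDesign) : PosDesign :=
  PFunctor.M.mk (F := signature) ⟨Root.act ξ I, fun p => f p.1 p.2⟩

/-- Every positive pseudo-design has exactly one of the three forms of the grammar. -/
theorem exists_form (φ : PosDesign) :
    φ = omega ∨ φ = daimon ∨ ∃ ξ I f, φ = act ξ I f := by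
  have h : PFunctor.M.mk (F := signature) (PFunctor.M.dest φ) = φ := PFunctor.M.mk_dest φ
  rcases hd : PFunctor.M.dest (F := signature) φ with ⟨a, f⟩
  rw [hd] at h
  cases a with
  | omega =>
    refine Or.inl (h.symm.trans ?_)
    have : f = Empty.elim := funext fun x => x.elim
    rw [this]; rfl
  | daimon =>
    refine Or.inr (Or.inl (h.symm.trans ?_))
    have : f = Empty.elim := funext fun x => x.elim
    rw [this]; rfl
  | act ξ I => exact Or.inr (Or.inr ⟨ξ, I, fun i J => f (i, J), h.symm⟩)

theorem omega_ne_daimon : omega ≠ daimon := by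
  intro h
  have h' := congrArg Sigma.fst (PFunctor.M.mk_inj h)
  cases h'

theorem omega_ne_act (ξ : Address) (I : Finset ℕ) (f : {i // i ∈ I} → Finset ℕ → PosDesign) :
    omega ≠ act ξ I f := by
  intro h
  have h' := congrArg Sigma.fst (PFunctor.M.mk_inj h)
  cases h'

theorem daimon_ne_act (ξ : Address) (I : Finset ℕ) (f : {i // i ∈ I} → Finset ℕ → PosDesign) :
    daimon ≠ act ξ I f := by
  intro h
  have h' := congrArg Sigma.fst (PFunctor.M.mk_inj h)
  cases h'

theorem act_inj {ξ ξ' : Address} {I I' : Finset ℕ} {f : {i // i ∈ I} → Finset ℕ → PosDesign}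
    {f' : {i // i ∈ I'} → Finset ℕ → PosDesign} (h : act ξ I f = act ξ' I' f') :
    ξ = ξ' ∧ I = I' ∧ HEq f f' := by
  have h' := PFunctor.M.mk_inj h
  injection h' with h1 h2
  injection h1 with h3 h4
  subst h3 h4
  refine ⟨rfl, rfl, heq_of_eq ?_⟩
  funext i J
  exact congrFun (eq_of_heq h2) (i, J)

end PosDesign

/-- Negative pseudo-designs `ψ_ζ = {(-, ζ, J) φ_J | J a finite set of natural numbers}`. -/
structure NegDesign : Type where
  focus : Address
  branch : Finset ℕ → PosDesign

/-- The typing rule of negative pseudo-designs, relative to a relation `T φ Γ` that stands for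
`φ : (⊢ Γ)`. -/
def NegRule (T : PosDesign → Finset Address → Prop) (ζ : Address) (g : Finset ℕ → PosDesign)
    (Λ : Finset Address) : Prop :=
  WellFormedNeg ζ Λ ∧ ∀ J, ∃ Λ', Λ' ⊆ Λ ∧ T (g J) (ζ.star J ∪ Λ')

/-- The typing rules of positive pseudo-designs, relative to a relation `T φ Γ` that stands for
`φ : (⊢ Γ)`. In the third rule the base `⊢ Γ` is written as `⊢ ξ, Λ` with `Λ = Γ \ {ξ}`. -/
def PosRule (T : PosDesign → Finset Address → Prop) (φ : PosDesign) (Γ : Finset Address) : Prop :=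
  WellFormed Γ ∧
    (φ = PosDesign.omega ∨ φ = PosDesign.daimon ∨
      ∃ ξ I f, φ = PosDesign.act ξ I f ∧ ξ ∈ Γ ∧
        ∃ Λ : {i // i ∈ I} → Finset Address,
          (∀ i, Λ i ⊆ Γ.erase ξ) ∧ (∀ i j, i ≠ j → Disjoint (Λ i) (Λ j)) ∧
          ∀ i : {i // i ∈ I}, NegRule T (ξ.child i) (f i) (Λ i))

/-- The typing judgement `φ : (⊢ Γ)`. The rules are read coinductively, since terms may be
infinite. -/
def PosDesign.HasBase (φ : PosDesign) (Γ : Finset Address) : Prop :=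
  ∃ T : PosDesign → Finset Address → Prop, (∀ φ' Γ', T φ' Γ' → PosRule T φ' Γ') ∧ T φ Γ

/-- The typing judgement `ψ : (ζ ⊢ Λ)`. -/
def NegDesign.HasBase (ψ : NegDesign) (ζ : Address) (Λ : Finset Address) : Prop :=
  ψ.focus = ζ ∧ NegRule PosDesign.HasBase ζ ψ.branch Λ

/-- The stable ordering `φ ⊆ φ'` of positive pseudo-designs: some occurrences of `Ω` in `φ` are
replaced by arbitrary trees. Its rules are read coinductively. -/
def PosDesign.Sub (φ φ' : PosDesign) : Prop :=
  ∃ R : PosDesign → PosDesign → Prop,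
    (∀ a b, R a b →
      a = PosDesign.omega ∨ (a = PosDesign.daimon ∧ b = PosDesign.daimon) ∨
      ∃ ξ I f g, a = PosDesign.act ξ I f ∧ b = PosDesign.act ξ I g ∧ ∀ i J, R (f i J) (g i J)) ∧
    R φ φ'

instance : HasSubset PosDesign := ⟨PosDesign.Sub⟩

/-- The stable ordering of negative pseudo-designs. -/
def NegDesign.Sub (ψ ψ' : NegDesign) : Prop :=
  ψ.focus = ψ'.focus ∧ ∀ J, ψ.branch J ⊆ ψ'.branch J

instance : HasSubset NegDesign := ⟨NegDesign.Sub⟩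

/-- Actions; `Ω` and `✠` count as positive actions. -/
inductive Move : Type
  | omega : Move
  | daimon : Move
  | pos (ξ : Address) (I : Finset ℕ) : Move
  | neg (ζ : Address) (J : Finset ℕ) : Move

/-- Sequences of actions. -/
abbrev Chronicle : Type := List Move

/-- `IsChronicle φ r`: the sequence `r` labels a branch of `φ` from the root to some node that is
labelled by `✠` or by an action `(+, ξ, I)`. -/
inductive IsChronicle : PosDesign → Chronicle → Prop
  | daimon : IsChronicle PosDesign.daimon [Move.daimon]
  | root (ξ : Address) (I : Finset ℕ) (f : {i // i ∈ I} → Finset ℕ → PosDesign) :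
      IsChronicle (PosDesign.act ξ I f) [Move.pos ξ I]
  | cons (ξ : Address) (I : Finset ℕ) (f : {i // i ∈ I} → Finset ℕ → PosDesign)
      (i : {i // i ∈ I}) (J : Finset ℕ) (r : Chronicle) : IsChronicle (f i J) r →
      IsChronicle (PosDesign.act ξ I f) (Move.pos ξ I :: Move.neg (ξ.child i) J :: r)

/-- A positive pseudo-design as a set of chronicles; the `Ω`'s disappear. -/
def PosDesign.chronicles (φ : PosDesign) : Set Chronicle := {r | IsChronicle φ r}

/-- A negative pseudo-design as a set of chronicles. -/
def NegDesign.chronicles (ψ : NegDesign) : Set Chronicle :=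
  {r | ∃ J r', r' ∈ (ψ.branch J).chronicles ∧ r = Move.neg ψ.focus J :: r'}

/-- A set `Ψ` of negative pseudo-designs with distinct foci, as a partial function: `Ψ` accepts `ζ`
if `Ψ ζ ≠ none`, and `Ψ ζ = some g` means that `Ψ_ζ = {(-, ζ, J) (g J)}_J`. -/
abbrev Env : Type := Address → Option (Finset ℕ → PosDesign)

/-- The singleton `{ψ}`. -/
def Env.single (ψ : NegDesign) : Env :=
  fun ζ => if ζ = ψ.focus then some ψ.branch else none

/-- `Ψ' ∪ (Ψ \ ξ)`, where `Ψ' = {ψ_{ξ i} | i ∈ I}` is given by `f`. -/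
noncomputable def Env.consume (Ψ : Env) (ξ : Address) (I : Finset ℕ)
    (f : {i // i ∈ I} → Finset ℕ → PosDesign) : Env :=
  Function.extend (fun i : {i // i ∈ I} => ξ.child i) (fun i => some (f i))
    (fun ζ => if ζ = ξ then none else Ψ ζ)

/-- States `⟨φ | Ψ⟩_q` of the normalization machine. -/
structure State : Type where
  code : PosDesign
  env : Env
  index : Chronicle

/-- Rule (R): `⟨(+,ξ,I)·Ψ' | Ψ⟩_q ⟶ ⟨Ψ_{ξ,I} | Ψ' ∪ (Ψ \ ξ)⟩_q` if `Ψ` accepts `ξ`. -/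
def RStep (s t : State) : Prop :=
  ∃ ξ I f g, s.code = PosDesign.act ξ I f ∧ s.env ξ = some g ∧
    t = ⟨g I, s.env.consume ξ I f, s.index⟩

/-- Rule (S): `⟨(+,ξ,I)·Ψ' | Ψ⟩_q ⟶ ⟨Ψ'_{ξi,J} | Ψ⟩_{q(+,ξ,I)(-,ξi,J)}` if `Ψ` does not accept `ξ`,
for all `i ∈ I` and `J`. -/
def SStep (s t : State) : Prop :=
  ∃ ξ I f, s.code = PosDesign.act ξ I f ∧ s.env ξ = none ∧
    ∃ (i : {i // i ∈ I}) (J : Finset ℕ),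
      t = ⟨f i J, s.env, s.index ++ [Move.pos ξ I, Move.neg (ξ.child i) J]⟩

/-- `s` is reached by the machine from the initial state `⟨φ | Ψ⟩_ε`. -/
def Reached (φ : PosDesign) (Ψ : Env) (s : State) : Prop :=
  Relation.ReflTransGen (fun s t => RStep s t ∨ SStep s t) ⟨φ, Ψ, []⟩ s

/-- The normal form of `⟨φ | Ψ⟩`: the set of all results of strong reduction. The four parts are
the positive actions that are not cut, the `Ω`'s met by the machine, the `✠`'s met by the machine,
and the `Ω`'s created by an infinite sequence of steps (R) at a constant index. -/
def normalForm (φ : PosDesign) (Ψ : Env) : Set Chronicle :=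
  {r | ∃ s ξ I f, Reached φ Ψ s ∧ s.code = PosDesign.act ξ I f ∧ s.env ξ = none ∧
      r = s.index ++ [Move.pos ξ I]} ∪
  {r | ∃ s, Reached φ Ψ s ∧ s.code = PosDesign.omega ∧ r = s.index ++ [Move.omega]} ∪
  {r | ∃ s, Reached φ Ψ s ∧ s.code = PosDesign.daimon ∧ r = s.index ++ [Move.daimon]} ∪
  {r | ∃ s : ℕ → State, Reached φ Ψ (s 0) ∧ (∀ n, RStep (s n) (s (n + 1))) ∧
      r = (s 0).index ++ [Move.omega]}

/-- The normal form `⟦φ, ψ⟧` of two pseudo-designs, including its chronicles `q Ω`. -/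
def nf (φ : PosDesign) (ψ : NegDesign) : Set Chronicle := normalForm φ (Env.single ψ)

/-- The normal form `⟦φ, ψ⟧` as a set of chronicles in the sense of `PosDesign.chronicles`,
that is, without its chronicles `q Ω`. -/
def nfChronicles (φ : PosDesign) (ψ : NegDesign) : Set Chronicle :=
  {r | r ∈ nf φ ψ ∧ r.getLast? ≠ some Move.omega}

/-- Orthogonality `φ ⊥ ψ`: the normal form is `✠`. -/
def Orthogonal (φ : PosDesign) (ψ : NegDesign) : Prop := nf φ ψ = {[Move.daimon]}

end Ludics

open Ludics

/-! A chronicle that does not end with `Ω` is produced by a finite run, recorded here as a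
derivation of `Eval`. Such a run meets no `Ω`, so it survives in larger designs (`Eval.mono`). It
also survives in intersections of designs below a common bound (`Eval.of_isInter`): the bound forces
all the runs producing `r` to meet the same actions, so they proceed in lockstep and the run of the
intersection goes along with them.

The chronicles `q Ω` reduce to `Eval` as well (`mem_normalForm`): `q Ω` occurs exactly when the
machine reaches index `q` and no chronicle extending `q` is produced. The first condition is again a
matter of evaluation, hence stable under intersections; the second passes to smaller designs by
monotonicity. So membership in the normal form is stable under bounded intersections
(`mem_nf_of_isInter`), and the minimum pair producing `r` is the intersection of all pairs below
`(φ, ψ)` that produce it. Intersections exist by corecursion (`inter`), and typing passes to smaller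
designs (`HasBase.mono`). -/

namespace Ludics

namespace PosDesign

theorem Sub.cases {a b : PosDesign} (h : a ⊆ b) :
    a = omega ∨ (a = daimon ∧ b = daimon) ∨
      ∃ ξ I f g, a = act ξ I f ∧ b = act ξ I g ∧ ∀ i J, f i J ⊆ g i J := by
  obtain ⟨R, hR, hab⟩ := h
  rcases hR a b hab with h | h | ⟨ξ, I, f, g, h1, h2, h3⟩
  · exact Or.inl h
  · exact Or.inr (Or.inl h)
  · exact Or.inr (Or.inr ⟨ξ, I, f, g, h1, h2, fun i J => ⟨R, hR, h3 i J⟩⟩)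

theorem act_injective {ξ : Address} {I : Finset ℕ} {f g : {i // i ∈ I} → Finset ℕ → PosDesign}
    (h : act ξ I f = act ξ I g) : f = g :=
  eq_of_heq (act_inj h).2.2

/-! ### Chronicles -/

theorem _root_.Ludics.Address.child_injective (ξ : Address) : Function.Injective ξ.child := by
  intro i j h
  simpa [Address.child] using h

theorem chronicles_omega : omega.chronicles = ∅ := by
  refine Set.eq_empty_of_forall_notMem fun r (h : IsChronicle _ _) => ?_
  generalize e : omega = a at h
  cases h with
  | daimon => exact omega_ne_daimon e
  | root => exact omega_ne_act _ _ _ e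
  | cons => exact omega_ne_act _ _ _ e

theorem mem_chronicles_daimon {r : Chronicle} : r ∈ daimon.chronicles ↔ r = [Move.daimon] := by
  refine ⟨fun (h : IsChronicle _ _) => ?_, fun h => h ▸ IsChronicle.daimon⟩
  generalize e : daimon = a at h
  cases h with
  | daimon => rfl
  | root => exact (daimon_ne_act _ _ _ e).elim
  | cons => exact (daimon_ne_act _ _ _ e).elim

theorem mem_chronicles_act {ξ : Address} {I : Finset ℕ}
    {f : {i // i ∈ I} → Finset ℕ → PosDesign} {r : Chronicle} :
    r ∈ (act ξ I f).chronicles ↔ r = [Move.pos ξ I] ∨ ∃ (i : {i // i ∈ I}) (J : Finset ℕ) (r' : Chronicle),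
      r = Move.pos ξ I :: Move.neg (ξ.child i) J :: r' ∧ r' ∈ (f i J).chronicles := by
  constructor
  · intro (h : IsChronicle _ _)
    generalize e : act ξ I f = a at h
    cases h with
    | daimon => exact (daimon_ne_act _ _ _ e.symm).elim
    | root =>
      obtain ⟨rfl, rfl, -⟩ := act_inj e
      exact Or.inl rfl
    | cons ξ' I' f' i J r' h =>
      obtain ⟨rfl, rfl, hf⟩ := act_inj e
      obtain rfl := eq_of_heq hf
      exact Or.inr ⟨i, J, r', rfl, h⟩
  · rintro (rfl | ⟨i, J, r', rfl, h⟩)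
    · exact IsChronicle.root _ _ _
    · exact IsChronicle.cons _ _ _ _ _ _ h

theorem cons_mem_chronicles_act {ξ : Address} {I : Finset ℕ}
    {f : {i // i ∈ I} → Finset ℕ → PosDesign} {i : {i // i ∈ I}} {J : Finset ℕ} {r : Chronicle} :
    Move.pos ξ I :: Move.neg (ξ.child i) J :: r ∈ (act ξ I f).chronicles ↔
      r ∈ (f i J).chronicles := by
  rw [mem_chronicles_act]
  constructor
  · rintro (h | ⟨i', J', r', h, hr⟩)
    · simp at h
    · simp only [List.cons.injEq, Move.neg.injEq, true_and] at h
      obtain ⟨⟨hi, rfl⟩, rfl⟩ := h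
      obtain rfl := Subtype.ext (ξ.child_injective hi)
      exact hr
  · exact fun h => Or.inr ⟨i, J, r, rfl, h⟩

theorem eq_daimon_of_mem_chronicles {a : PosDesign} (h : [Move.daimon] ∈ a.chronicles) :
    a = daimon := by
  rcases exists_form a with rfl | rfl | ⟨ξ, I, f, rfl⟩
  · simp [chronicles_omega] at h
  · rfl
  · rw [mem_chronicles_act] at h
    simp at h

theorem eq_act_of_mem_chronicles {a : PosDesign} {ξ : Address} {I : Finset ℕ}
    (h : [Move.pos ξ I] ∈ a.chronicles) : ∃ f, a = act ξ I f := by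
  rcases exists_form a with rfl | rfl | ⟨ξ', I', f, rfl⟩
  · simp [chronicles_omega] at h
  · simp [mem_chronicles_daimon] at h
  · rw [mem_chronicles_act] at h
    simp only [List.cons.injEq, Move.pos.injEq, and_true, reduceCtorEq, and_false, false_and,
      exists_false, or_false] at h
    obtain ⟨rfl, rfl⟩ := h
    exact ⟨f, rfl⟩

/-- A chronicle of length one determines the root of any design containing it, so inclusion of
chronicles is itself a relation closed under the coinductive rules of the ordering. -/
theorem sub_iff_chronicles_subset {a b : PosDesign} : a ⊆ b ↔ a.chronicles ⊆ b.chronicles := by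
  constructor
  · intro hab r (hr : IsChronicle a r)
    induction hr generalizing b with
    | daimon =>
      rcases hab.cases with h | ⟨-, rfl⟩ | ⟨ξ, I, f, g, h, -, -⟩
      · exact (omega_ne_daimon h.symm).elim
      · exact IsChronicle.daimon
      · exact (daimon_ne_act _ _ _ h).elim
    | root ξ I f =>
      rcases hab.cases with h | ⟨h, -⟩ | ⟨ξ', I', f', g, h, rfl, -⟩
      · exact (omega_ne_act _ _ _ h.symm).elim
      · exact (daimon_ne_act _ _ _ h.symm).elim
      · obtain ⟨rfl, rfl, -⟩ := act_inj h
        exact IsChronicle.root _ _ _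
    | cons ξ I f i J r _ ih =>
      rcases hab.cases with h | ⟨h, -⟩ | ⟨ξ', I', f', g, h, rfl, hs⟩
      · exact (omega_ne_act _ _ _ h.symm).elim
      · exact (daimon_ne_act _ _ _ h.symm).elim
      · obtain ⟨rfl, rfl, hf⟩ := act_inj h
        obtain rfl := eq_of_heq hf
        exact IsChronicle.cons _ _ _ _ _ _ (ih (hs i J))
  · refine fun hab => ⟨fun a b => a.chronicles ⊆ b.chronicles, fun a b h => ?_, hab⟩
    rcases exists_form a with rfl | rfl | ⟨ξ, I, f, rfl⟩
    · exact Or.inl rfl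
    · exact Or.inr (Or.inl ⟨rfl, eq_daimon_of_mem_chronicles (h IsChronicle.daimon)⟩)
    · obtain ⟨g, rfl⟩ := eq_act_of_mem_chronicles (h (IsChronicle.root ξ I f))
      exact Or.inr (Or.inr ⟨ξ, I, f, g, rfl, rfl, fun i J r hr =>
        cons_mem_chronicles_act.1 (h (cons_mem_chronicles_act.2 hr))⟩)

theorem sub_trans {a b c : PosDesign} (hab : a ⊆ b) (hbc : b ⊆ c) : a ⊆ c := by
  rw [sub_iff_chronicles_subset] at *
  exact Set.Subset.trans hab hbc

theorem sub_refl {a : PosDesign} : a ⊆ a :=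
  sub_iff_chronicles_subset.2 subset_rfl

/-! ### Typing of smaller designs -/

theorem HasBase.posRule {a : PosDesign} {Γ : Finset Address} (h : a.HasBase Γ) :
    PosRule HasBase a Γ := by
  obtain ⟨T, hT, ha⟩ := h
  obtain ⟨hΓ, h⟩ := hT a Γ ha
  refine ⟨hΓ, h.imp_right (Or.imp_right ?_)⟩
  rintro ⟨ξ, I, f, rfl, hξ, Λ, h1, h2, h3⟩
  refine ⟨ξ, I, f, rfl, hξ, Λ, h1, h2, fun i => ⟨(h3 i).1, fun J => ?_⟩⟩
  obtain ⟨Λ', hΛ', h⟩ := (h3 i).2 J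
  exact ⟨Λ', hΛ', T, hT, h⟩

/-- By coinduction, with the relation "below some design of base `Γ`": `Ω` has every well-formed
base, and elsewhere the contexts chosen for the larger design still work. -/
theorem HasBase.mono {a b : PosDesign} {Γ : Finset Address} (hb : b.HasBase Γ) (hab : a ⊆ b) :
    a.HasBase Γ := by
  refine ⟨fun a Γ => ∃ b : PosDesign, a ⊆ b ∧ b.HasBase Γ, ?_, b, hab, hb⟩
  rintro a Γ ⟨b, hab, hb⟩
  obtain ⟨hΓ, h⟩ := hb.posRule
  refine ⟨hΓ, ?_⟩
  rcases hab.cases with ha | ⟨ha, -⟩ | ⟨ξ, I, f, g, rfl, rfl, hfg⟩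
  · exact Or.inl ha
  · exact Or.inr (Or.inl ha)
  · rcases h with h | h | ⟨ξ', I', g', h, hξ, Λ, h1, h2, h3⟩
    · exact (omega_ne_act _ _ _ h.symm).elim
    · exact (daimon_ne_act _ _ _ h.symm).elim
    · obtain ⟨rfl, rfl, hg⟩ := act_inj h
      obtain rfl := eq_of_heq hg
      refine Or.inr (Or.inr ⟨ξ, I, f, rfl, hξ, Λ, h1, h2, fun i => ⟨(h3 i).1, fun J => ?_⟩⟩)
      obtain ⟨Λ', hΛ', h⟩ := (h3 i).2 J
      exact ⟨Λ', hΛ', g i J, hfg i J, h⟩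

end PosDesign

theorem NegDesign.HasBase.mono {a b : NegDesign} {ζ : Address} {Λ : Finset Address}
    (hb : b.HasBase ζ Λ) (hab : a ⊆ b) : a.HasBase ζ Λ := by
  refine ⟨hab.1.trans hb.1, hb.2.1, fun J => ?_⟩
  obtain ⟨Λ', hΛ', h⟩ := hb.2.2 J
  exact ⟨Λ', hΛ', h.mono (hab.2 J)⟩

/-! ### Intersections -/

namespace PosDesign

/-- `a` is the intersection of the designs `as k`, as sets of chronicles. -/
def IsInter {ι : Sort*} (a : PosDesign) (as : ι → PosDesign) : Prop :=
  a.chronicles = ⋂ k, (as k).chronicles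

section

variable {ι : Sort*} {a : PosDesign} {as : ι → PosDesign}

theorem IsInter.sub (h : IsInter a as) (k : ι) : a ⊆ as k :=
  sub_iff_chronicles_subset.2 (h.subset.trans (Set.iInter_subset _ k))

theorem IsInter.eq_daimon (h : IsInter a as) (has : ∀ k, as k = daimon) : a = daimon := by
  apply eq_daimon_of_mem_chronicles
  rw [h]
  exact Set.mem_iInter.2 fun k => has k ▸ IsChronicle.daimon

theorem IsInter.exists_eq_act {ξ : Address} {I : Finset ℕ}
    {fs : ι → {i // i ∈ I} → Finset ℕ → PosDesign} (h : IsInter a as)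
    (has : ∀ k, as k = act ξ I (fs k)) :
    ∃ f, a = act ξ I f ∧ ∀ i J, IsInter (f i J) fun k => fs k i J := by
  obtain ⟨f, rfl⟩ : ∃ f, a = act ξ I f := by
    apply eq_act_of_mem_chronicles
    rw [h]
    exact Set.mem_iInter.2 fun k => has k ▸ IsChronicle.root _ _ _
  refine ⟨f, rfl, fun i J => Set.ext fun r => ?_⟩
  rw [← cons_mem_chronicles_act, h, Set.mem_iInter, Set.mem_iInter]
  refine forall_congr' fun k => ?_
  rw [has k, cons_mem_chronicles_act]

theorem forall_eq_daimon_of_sub {b : PosDesign} {k₀ : ι} (hb : ∀ k, as k ⊆ b)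
    (hne : ∀ k, as k ≠ omega) (h₀ : as k₀ = daimon) (k : ι) : as k = daimon := by
  rcases (hb k).cases with h | ⟨h, -⟩ | ⟨ξ, I, f, g, h, hg, -⟩
  · exact (hne k h).elim
  · exact h
  · rcases (hb k₀).cases with h' | ⟨-, h'⟩ | ⟨_, _, _, _, h', -, -⟩
    · exact (hne _ h').elim
    · exact (daimon_ne_act _ _ _ (h'.symm.trans hg)).elim
    · exact (daimon_ne_act _ _ _ (h₀.symm.trans h')).elim

/-- Under a common bound, designs other than `Ω` all share the root of the bound. This is what
synchronizes the runs; with a one-element family it serves as inversion of the ordering at an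
action. -/
theorem exists_forall_eq_act_of_sub {b : PosDesign} {k₀ : ι} {ξ : Address} {I : Finset ℕ}
    {f₀ : {i // i ∈ I} → Finset ℕ → PosDesign} (hb : ∀ k, as k ⊆ b)
    (hne : ∀ k, as k ≠ omega) (h₀ : as k₀ = act ξ I f₀) :
    ∃ (fs : ι → {i // i ∈ I} → Finset ℕ → PosDesign) (g : {i // i ∈ I} → Finset ℕ → PosDesign),
      (∀ k, as k = act ξ I (fs k)) ∧ b = act ξ I g ∧ ∀ k i J, fs k i J ⊆ g i J := by
  obtain ⟨g, rfl⟩ : ∃ g, b = act ξ I g := by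
    rcases (hb k₀).cases with h | ⟨h, -⟩ | ⟨ξ', I', f', g, h, rfl, -⟩
    · exact (hne _ h).elim
    · exact (daimon_ne_act _ _ _ (h.symm.trans h₀)).elim
    · obtain ⟨rfl, rfl, -⟩ := act_inj (h₀.symm.trans h)
      exact ⟨g, rfl⟩
  have key : ∀ k, ∃ f, as k = act ξ I f ∧ ∀ i J, f i J ⊆ g i J := by
    intro k
    rcases (hb k).cases with h | ⟨-, h⟩ | ⟨ξ', I', f', g', h, h', hs⟩
    · exact (hne _ h).elim
    · exact (daimon_ne_act _ _ _ h.symm).elim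
    · obtain ⟨rfl, rfl, hg⟩ := act_inj h'
      obtain rfl := eq_of_heq hg
      exact ⟨f', h, hs⟩
  choose fs h1 h2 using key
  exact ⟨fs, g, h1, rfl, h2⟩

end

/-! ### Construction of intersections by corecursion -/

open Classical in
/-- One layer of the intersection of a set of designs. -/
noncomputable def interStep (S : Set PosDesign) : signature (Set PosDesign) :=
  -- The empty set falls under this case, a harmless default.
  if ∀ a ∈ S, a = daimon then ⟨Root.daimon, Empty.elim⟩
  else if h : ∃ ξ I, ∀ a ∈ S, ∃ f, a = act ξ I f then
    ⟨Root.act h.choose h.choose_spec.choose,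
      fun p => {b | ∃ f, act h.choose h.choose_spec.choose f ∈ S ∧ b = f p.1 p.2}⟩
  else ⟨Root.omega, Empty.elim⟩

/-- The intersection of a set of designs. -/
noncomputable def inter (S : Set PosDesign) : PosDesign :=
  PFunctor.M.corec interStep S

theorem inter_eq_mk {S : Set PosDesign} {x : signature (Set PosDesign)} (h : interStep S = x) :
    inter S = PFunctor.M.mk (F := signature) (signature.map (PFunctor.M.corec interStep) x) := by
  subst h
  exact PFunctor.M.corec_def interStep S

theorem inter_of_forall_eq_daimon {S : Set PosDesign} (h : ∀ a ∈ S, a = daimon) :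
    inter S = daimon :=
  (inter_eq_mk (if_pos h)).trans <| congrArg (PFunctor.M.mk (F := signature)) <|
    congrArg (Sigma.mk _) (funext fun x => x.elim)

theorem inter_of_forall_eq_act {S : Set PosDesign} (hS : S.Nonempty) {ξ : Address}
    {I : Finset ℕ} (h : ∀ a ∈ S, ∃ f, a = act ξ I f) :
    inter S = act ξ I fun i J => inter {b | ∃ f, act ξ I f ∈ S ∧ b = f i J} := by
  obtain ⟨a, ha⟩ := hS
  obtain ⟨f, rfl⟩ := h a ha
  have h1 : ¬ ∀ a ∈ S, a = daimon := fun h' => daimon_ne_act _ _ _ (h' _ ha).symm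
  have h2 : ∃ ξ I, ∀ a ∈ S, ∃ f, a = act ξ I f := ⟨ξ, I, h⟩
  obtain ⟨f', hf'⟩ := h2.choose_spec.choose_spec _ ha
  obtain ⟨e1, e2, -⟩ := act_inj hf'
  have key : interStep S =
      ⟨Root.act ξ I, fun p => {b | ∃ f, act ξ I f ∈ S ∧ b = f p.1 p.2}⟩ := by
    refine (if_neg h1).trans ((dif_pos h2).trans ?_)
    -- The label picked by choice is the right one because `S` has an element; it is generalized so
    -- that it can be substituted in the dependent type of the sons.
    generalize h2.choose_spec.choose = I' at e2 ⊢
    generalize h2.choose = ξ' at e1 ⊢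
    subst e1 e2
    rfl
  exact inter_eq_mk key

theorem inter_of_not {S : Set PosDesign} (h1 : ¬ ∀ a ∈ S, a = daimon)
    (h2 : ¬ ∃ ξ I, ∀ a ∈ S, ∃ f, a = act ξ I f) : inter S = omega :=
  (inter_eq_mk ((if_neg h1).trans (dif_neg h2))).trans <|
    congrArg (PFunctor.M.mk (F := signature)) <|
      congrArg (Sigma.mk _) (funext fun x => x.elim)

theorem inter_sub {S : Set PosDesign} {a : PosDesign} (ha : a ∈ S) : inter S ⊆ a := by
  refine ⟨fun x y => ∃ S : Set PosDesign, x = inter S ∧ y ∈ S, ?_, S, rfl, ha⟩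
  rintro x y ⟨S, rfl, hy⟩
  by_cases h1 : ∀ a ∈ S, a = daimon
  · exact Or.inr (Or.inl ⟨inter_of_forall_eq_daimon h1, h1 y hy⟩)
  by_cases h2 : ∃ ξ I, ∀ a ∈ S, ∃ f, a = act ξ I f
  · obtain ⟨ξ, I, h⟩ := h2
    obtain ⟨f, rfl⟩ := h y hy
    exact Or.inr (Or.inr ⟨ξ, I, _, f, inter_of_forall_eq_act ⟨_, hy⟩ h, rfl,
      fun i J => ⟨_, rfl, f, hy, rfl⟩⟩)
  · exact Or.inl (inter_of_not h1 h2)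

/-- No bound is needed: a common chronicle already forces the roots to agree. Going down one layer
removes a positive and a negative action, hence the two-step induction. -/
theorem mem_chronicles_inter {S : Set PosDesign} (hS : S.Nonempty) {r : Chronicle} :
    r ∈ (inter S).chronicles ↔ ∀ a ∈ S, r ∈ a.chronicles := by
  refine ⟨fun h a ha => sub_iff_chronicles_subset.1 (inter_sub ha) h, fun h => ?_⟩
  induction r using List.twoStepInduction generalizing S with
  | nil =>
    obtain ⟨a, ha⟩ := hS
    obtain h : IsChronicle a [] := h a ha
    cases h
  | singleton m =>
    obtain ⟨a, ha⟩ := hS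
    obtain h' : IsChronicle a [m] := h a ha
    cases h' with
    | daimon =>
      rw [inter_of_forall_eq_daimon fun b hb => eq_daimon_of_mem_chronicles (h b hb)]
      exact IsChronicle.daimon
    | root ξ I f =>
      rw [inter_of_forall_eq_act ⟨_, ha⟩ fun b hb => eq_act_of_mem_chronicles (h b hb)]
      exact IsChronicle.root _ _ _
  | cons_cons m n r ih _ =>
    obtain ⟨a, ha⟩ := hS
    obtain h' : IsChronicle a (m :: n :: r) := h a ha
    cases h' with
    | cons ξ I f i J r h' =>
      have hact : ∀ b ∈ S, ∃ g, b = act ξ I g := by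
        intro b hb
        rcases exists_form b with rfl | rfl | ⟨ξ', I', g, rfl⟩
        · simpa [chronicles_omega] using h _ hb
        · simpa [mem_chronicles_daimon] using h _ hb
        · rcases mem_chronicles_act.1 (h _ hb) with h | ⟨_, _, _, h, -⟩
          · simp at h
          · simp only [List.cons.injEq, Move.pos.injEq] at h
            obtain ⟨⟨rfl, rfl⟩, -⟩ := h
            exact ⟨g, rfl⟩
      rw [inter_of_forall_eq_act ⟨_, ha⟩ hact, cons_mem_chronicles_act]
      refine ih (Set.nonempty_of_mem ⟨f, ha, rfl⟩) ?_
      rintro _ ⟨g, hg, rfl⟩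
      exact cons_mem_chronicles_act.1 (h _ hg)

theorem isInter_inter_range {ι : Sort*} [Nonempty ι] (as : ι → PosDesign) :
    IsInter (inter (Set.range as)) as := by
  ext r
  rw [mem_chronicles_inter (Set.range_nonempty as), Set.forall_mem_range, Set.mem_iInter]

end PosDesign

/-! ### Environments -/

/-- The extension to environments of the stable ordering. -/
def Env.Sub (Ψ Ψ' : Env) : Prop :=
  ∀ ζ, (Ψ ζ = none ∧ Ψ' ζ = none) ∨
    ∃ g g', Ψ ζ = some g ∧ Ψ' ζ = some g' ∧ ∀ J, g J ⊆ g' J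

/-- The extension to environments of intersection. -/
def Env.IsInter {ι : Sort*} (Ψ : Env) (Ψs : ι → Env) : Prop :=
  ∀ ζ, (Ψ ζ = none ∧ ∀ k, Ψs k ζ = none) ∨
    ∃ (g : Finset ℕ → PosDesign) (gs : ι → Finset ℕ → PosDesign), Ψ ζ = some g ∧
      (∀ k, Ψs k ζ = some (gs k)) ∧ ∀ J, PosDesign.IsInter (g J) fun k => gs k J

namespace Env

theorem Sub.none {Ψ Ψ' : Env} (h : Ψ.Sub Ψ') {ζ : Address} (hζ : Ψ ζ = none) : Ψ' ζ = none := by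
  rcases h ζ with h | ⟨g, g', h, -⟩
  · exact h.2
  · simp [hζ] at h

theorem Sub.some {Ψ Ψ' : Env} (h : Ψ.Sub Ψ') {ζ : Address} {g : Finset ℕ → PosDesign}
    (hζ : Ψ ζ = some g) : ∃ g', Ψ' ζ = Option.some g' ∧ ∀ J, g J ⊆ g' J := by
  rcases h ζ with h | ⟨g₁, g', h, h', hs⟩
  · simp [hζ] at h
  · obtain rfl := Option.some.inj (hζ.symm.trans h)
    exact ⟨g', h', hs⟩

theorem Sub.consume {Ψ Ψ' : Env} (h : Ψ.Sub Ψ') (ξ : Address) {I : Finset ℕ}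
    {f f' : {i // i ∈ I} → Finset ℕ → PosDesign} (hf : ∀ i J, f i J ⊆ f' i J) :
    (Ψ.consume ξ I f).Sub (Ψ'.consume ξ I f') := by
  intro ζ
  rw [Env.consume, Env.consume, Function.extend_def, Function.extend_def]
  split_ifs with h1 h2
  · exact Or.inr ⟨_, _, rfl, rfl, hf _⟩
  · exact Or.inl ⟨rfl, rfl⟩
  · exact h ζ

theorem IsInter.consume {ι : Sort*} {Ψ : Env} {Ψs : ι → Env} (h : Ψ.IsInter Ψs) (ξ : Address)
    {I : Finset ℕ} {f : {i // i ∈ I} → Finset ℕ → PosDesign}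
    {fs : ι → {i // i ∈ I} → Finset ℕ → PosDesign}
    (hf : ∀ i J, PosDesign.IsInter (f i J) fun k => fs k i J) :
    (Ψ.consume ξ I f).IsInter fun k => (Ψs k).consume ξ I (fs k) := by
  intro ζ
  simp only [Env.consume, Function.extend_def]
  split_ifs with h1 h2
  · exact Or.inr ⟨_, _, rfl, fun k => rfl, hf _⟩
  · exact Or.inl ⟨rfl, fun k => rfl⟩
  · exact h ζ

theorem Sub.single {ψ ψ' : NegDesign} (h : ψ ⊆ ψ') : (single ψ).Sub (single ψ') := by
  intro ζ
  rw [Env.single, Env.single, ← h.1]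
  split_ifs
  · exact Or.inr ⟨_, _, rfl, rfl, h.2⟩
  · exact Or.inl ⟨rfl, rfl⟩

theorem IsInter.single {ι : Sort*} {ψ : NegDesign} {ψs : ι → NegDesign}
    (hfocus : ∀ k, (ψs k).focus = ψ.focus)
    (h : ∀ J, PosDesign.IsInter (ψ.branch J) fun k => (ψs k).branch J) :
    (single ψ).IsInter fun k => single (ψs k) := by
  intro ζ
  simp only [Env.single, hfocus]
  split_ifs
  · exact Or.inr ⟨_, _, rfl, fun k => rfl, h⟩
  · exact Or.inl ⟨rfl, fun k => rfl⟩

end Env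

/-! ### Evaluation of a single chronicle -/

/-- `Eval φ Ψ r`: the machine on `⟨φ | Ψ⟩` produces the chronicle `r`, which does not end
with `Ω`. -/
inductive Eval : PosDesign → Env → Chronicle → Prop
  | daimon (Ψ : Env) : Eval PosDesign.daimon Ψ [Move.daimon]
  | uncut {ξ : Address} {I : Finset ℕ} {f : {i // i ∈ I} → Finset ℕ → PosDesign} {Ψ : Env} :
      Ψ ξ = none → Eval (PosDesign.act ξ I f) Ψ [Move.pos ξ I]
  | cut {ξ : Address} {I : Finset ℕ} {f : {i // i ∈ I} → Finset ℕ → PosDesign} {Ψ : Env}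
      {g : Finset ℕ → PosDesign} {r : Chronicle} : Ψ ξ = some g →
      Eval (g I) (Ψ.consume ξ I f) r → Eval (PosDesign.act ξ I f) Ψ r
  | explore {ξ : Address} {I : Finset ℕ} {f : {i // i ∈ I} → Finset ℕ → PosDesign} {Ψ : Env}
      {i : {i // i ∈ I}} {J : Finset ℕ} {r : Chronicle} : Ψ ξ = none →
      Eval (f i J) Ψ r →
      Eval (PosDesign.act ξ I f) Ψ (Move.pos ξ I :: Move.neg (ξ.child i) J :: r)

namespace Eval

open PosDesign

theorem not_omega {Ψ : Env} {r : Chronicle} : ¬ Eval omega Ψ r := by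
  intro h
  generalize e : omega = a at h
  cases h with
  | daimon => exact omega_ne_daimon e
  | uncut => exact omega_ne_act _ _ _ e
  | cut => exact omega_ne_act _ _ _ e
  | explore => exact omega_ne_act _ _ _ e

theorem eq_of_daimon {Ψ : Env} {r : Chronicle} (h : Eval PosDesign.daimon Ψ r) :
    r = [Move.daimon] := by
  generalize e : PosDesign.daimon = a at h
  cases h with
  | daimon => rfl
  | uncut => exact (daimon_ne_act _ _ _ e).elim
  | cut => exact (daimon_ne_act _ _ _ e).elim
  | explore => exact (daimon_ne_act _ _ _ e).elim

section

variable {ξ : Address} {I : Finset ℕ} {f : {i // i ∈ I} → Finset ℕ → PosDesign} {Ψ : Env}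
  {r : Chronicle}

theorem act_iff_of_some {g : Finset ℕ → PosDesign} (hΨ : Ψ ξ = some g) :
    Eval (act ξ I f) Ψ r ↔ Eval (g I) (Ψ.consume ξ I f) r := by
  refine ⟨fun h => ?_, cut hΨ⟩
  generalize e : act ξ I f = a at h
  cases h with
  | daimon => exact (daimon_ne_act _ _ _ e.symm).elim
  | uncut h =>
    obtain ⟨rfl, rfl, -⟩ := act_inj e
    simp [hΨ] at h
  | cut h h' =>
    obtain ⟨rfl, rfl, hf⟩ := act_inj e
    obtain rfl := eq_of_heq hf
    obtain rfl := Option.some.inj (hΨ.symm.trans h)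
    exact h'
  | explore h =>
    obtain ⟨rfl, rfl, -⟩ := act_inj e
    simp [hΨ] at h

theorem act_of_none (hΨ : Ψ ξ = none) (h : Eval (act ξ I f) Ψ r) :
    r = [Move.pos ξ I] ∨ ∃ (i : {i // i ∈ I}) (J : Finset ℕ) (r' : Chronicle), r = Move.pos ξ I :: Move.neg (ξ.child i) J :: r' ∧
      Eval (f i J) Ψ r' := by
  generalize e : act ξ I f = a at h
  cases h with
  | daimon => exact (daimon_ne_act _ _ _ e.symm).elim
  | uncut h =>
    obtain ⟨rfl, rfl, -⟩ := act_inj e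
    exact Or.inl rfl
  | cut h =>
    obtain ⟨rfl, rfl, -⟩ := act_inj e
    simp [hΨ] at h
  | explore h h' =>
    obtain ⟨rfl, rfl, hf⟩ := act_inj e
    obtain rfl := eq_of_heq hf
    exact Or.inr ⟨_, _, _, rfl, h'⟩

theorem cons_act_iff_of_none (hΨ : Ψ ξ = none) {i : {i // i ∈ I}} {J : Finset ℕ} :
    Eval (act ξ I f) Ψ (Move.pos ξ I :: Move.neg (ξ.child i) J :: r) ↔ Eval (f i J) Ψ r := by
  refine ⟨fun h => ?_, explore hΨ⟩
  rcases act_of_none hΨ h with h | ⟨i', J', r', h, hr⟩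
  · simp at h
  · simp only [List.cons.injEq, Move.neg.injEq, true_and] at h
    obtain ⟨⟨hi, rfl⟩, rfl⟩ := h
    obtain rfl := Subtype.ext (ξ.child_injective hi)
    exact hr

end

/-- A derivation never visits `Ω`, so the larger design has the same root at every step. -/
theorem mono {a b : PosDesign} {Ψ Ψ' : Env} {r : Chronicle} (h : Eval a Ψ r) (hab : a ⊆ b)
    (hΨ : Ψ.Sub Ψ') : Eval b Ψ' r := by
  induction h generalizing b Ψ' with
  | daimon Ψ =>
    rcases hab.cases with h | ⟨-, rfl⟩ | ⟨ξ, I, f, g, h, -, -⟩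
    · exact (omega_ne_daimon h.symm).elim
    · exact Eval.daimon _
    · exact (daimon_ne_act _ _ _ h).elim
  | uncut h0 =>
    obtain ⟨fs, g, -, rfl, -⟩ := exists_forall_eq_act_of_sub (fun _ : Unit => hab)
      (fun _ => (omega_ne_act _ _ _).symm) (k₀ := ()) rfl
    exact uncut (hΨ.none h0)
  | cut h0 _ ih =>
    obtain ⟨fs, g, h, rfl, hs⟩ := exists_forall_eq_act_of_sub (fun _ : Unit => hab)
      (fun _ => (omega_ne_act _ _ _).symm) (k₀ := ()) rfl
    obtain rfl := act_injective (h ())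
    obtain ⟨g', hg', hgg'⟩ := hΨ.some h0
    exact cut hg' (ih (hgg' _) (hΨ.consume _ (hs ())))
  | explore h0 _ ih =>
    obtain ⟨fs, g, h, rfl, hs⟩ := exists_forall_eq_act_of_sub (fun _ : Unit => hab)
      (fun _ => (omega_ne_act _ _ _).symm) (k₀ := ()) rfl
    obtain rfl := act_injective (h ())
    exact explore (hΨ.none h0) (ih (hs () _ _) hΨ)

/-- Evaluation commutes with bounded intersections. -/
theorem of_isInter {ι : Sort*} {k₀ : ι} {a b : PosDesign} {as : ι → PosDesign} {Ψ Ψb : Env}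
    {Ψs : ι → Env} {r : Chronicle} (ha : PosDesign.IsInter a as) (hΨ : Ψ.IsInter Ψs)
    (hb : ∀ k, as k ⊆ b) (hΨb : ∀ k, (Ψs k).Sub Ψb) (h : ∀ k, Eval (as k) (Ψs k) r) :
    Eval a Ψ r := by
  obtain ⟨a₀, ha₀⟩ : ∃ a₀, as k₀ = a₀ := ⟨_, rfl⟩
  obtain ⟨Ψ₀, hΨ₀⟩ : ∃ Ψ₀, Ψs k₀ = Ψ₀ := ⟨_, rfl⟩
  have h₀ := h k₀
  rw [ha₀, hΨ₀] at h₀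
  have hne : ∀ {as : ι → PosDesign} {Ψs : ι → Env} {r : Chronicle},
      (∀ k, Eval (as k) (Ψs k) r) → ∀ k, as k ≠ omega := by
    intro as Ψs r h k hk
    exact not_omega (hk ▸ h k)
  -- The induction follows the derivation at the single index `k₀`; the derivations at the other
  -- indices are inverted along it.
  induction h₀ generalizing a b as Ψ Ψb Ψs with
  | daimon Ψ =>
    rw [ha.eq_daimon (forall_eq_daimon_of_sub hb (hne h) ha₀)]
    exact Eval.daimon _
  | @uncut ξ I f _ h0 =>
    obtain ⟨fs, g, has, rfl, hs⟩ := exists_forall_eq_act_of_sub hb (hne h) ha₀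
    obtain ⟨f, rfl, hf⟩ := ha.exists_eq_act has
    rcases hΨ ξ with ⟨h1, -⟩ | ⟨_, _, -, h1, -⟩
    · exact uncut h1
    · simp [← hΨ₀, h1] at h0
  | @cut ξ I f _ g₀ r h0 _ ih =>
    obtain ⟨fs, g, has, rfl, hs⟩ := exists_forall_eq_act_of_sub hb (hne h) ha₀
    obtain ⟨f, rfl, hf⟩ := ha.exists_eq_act has
    rcases hΨ ξ with ⟨-, h1⟩ | ⟨g', gs, h1, h2, h3⟩
    · simp [← hΨ₀, h1] at h0
    obtain ⟨gb, hgb, -⟩ := (hΨb k₀).some (h2 k₀)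
    -- The entry `gb` was found at `k₀`, but it belongs to the bound `Ψb`, so it bounds the entries
    -- at all indices.
    have hsub : ∀ k J, gs k J ⊆ gb J := by
      intro k
      obtain ⟨g₁, hg₁, h⟩ := (hΨb k).some (h2 k)
      obtain rfl := Option.some.inj (hgb.symm.trans hg₁)
      exact h
    refine cut h1 (ih (h3 I) (hΨ.consume ξ hf) (fun k => hsub k I)
      (fun k => (hΨb k).consume ξ (hs k)) (fun k => ?_) ?_ ?_)
    · have := h k
      rwa [has k, act_iff_of_some (h2 k)] at this
    · obtain rfl := Option.some.inj (h0.symm.trans (hΨ₀ ▸ h2 k₀))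
      rfl
    · rw [hΨ₀, act_injective ((has k₀).symm.trans ha₀)]
  | @explore ξ I f _ i J r h0 _ ih =>
    obtain ⟨fs, g, has, rfl, hs⟩ := exists_forall_eq_act_of_sub hb (hne h) ha₀
    obtain ⟨f', rfl, hf⟩ := ha.exists_eq_act has
    rcases hΨ ξ with ⟨h1, h2⟩ | ⟨_, _, -, h1, -⟩
    · refine explore h1 (ih (hf i J) hΨ (fun k => hs k i J) hΨb (fun k => ?_) ?_ hΨ₀)
      · have := h k
        rwa [has k, cons_act_iff_of_none (h2 k)] at this
      · rw [act_injective ((has k₀).symm.trans ha₀)]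
    · simp [← hΨ₀, h1] at h0

/-- A derivation of `✠` alone uses only cuts, and cuts leave no choice. -/
theorem eq_daimon {a : PosDesign} {Ψ : Env} {r : Chronicle} (h : Eval a Ψ [Move.daimon])
    (hr : Eval a Ψ r) : r = [Move.daimon] := by
  generalize e : [Move.daimon] = r₀ at h
  induction h with
  | daimon => exact eq_of_daimon hr
  | uncut => simp at e
  | cut h0 _ ih => exact ih ((act_iff_of_some h0).1 hr) e
  | explore => simp at e

end Eval

/-! ### The machine -/

/-- One step of the machine. -/
def Step (s t : State) : Prop := RStep s t ∨ SStep s t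

theorem RStep.index_eq {s t : State} (h : RStep s t) : t.index = s.index := by
  obtain ⟨ξ, I, f, g, -, -, rfl⟩ := h
  rfl

theorem RStep.eval_iff {s t : State} (h : RStep s t) {r : Chronicle} :
    Eval s.code s.env r ↔ Eval t.code t.env r := by
  obtain ⟨ξ, I, f, g, hc, hg, rfl⟩ := h
  rw [hc]
  exact Eval.act_iff_of_some hg

/-- Here `p` is what the machine writes between `s` and `t`. The only choices are those of `i` and
`J` in (S), and `p` records them, so evaluating along `p` leads back to `t`. -/
theorem exists_eval_iff {s t : State} (h : Relation.ReflTransGen Step s t) :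
    ∃ p, t.index = s.index ++ p ∧ ∀ r, Eval s.code s.env (p ++ r) ↔ Eval t.code t.env r := by
  induction h with
  | refl => exact ⟨[], by simp, fun r => by simp⟩
  | tail _ h ih =>
    obtain ⟨p, hp, ih⟩ := ih
    rcases h with h | ⟨ξ, I, f, hc, hξ, i, J, rfl⟩
    · exact ⟨p, h.index_eq.trans hp, fun r => (ih r).trans h.eval_iff⟩
    · refine ⟨p ++ [Move.pos ξ I, Move.neg (ξ.child i) J], by simp [hp], fun r => ?_⟩
      rw [List.append_assoc, ih, hc]
      exact Eval.cons_act_iff_of_none hξ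

theorem Reached.eval_iff {φ : PosDesign} {Ψ : Env} {s : State} (h : Reached φ Ψ s)
    {r : Chronicle} : Eval φ Ψ (s.index ++ r) ↔ Eval s.code s.env r := by
  obtain ⟨p, hp, h⟩ := exists_eval_iff h
  obtain rfl : s.index = p := hp
  exact h r

/-- The machine on `⟨φ | Ψ⟩` reaches the index `q`. -/
def Live (φ : PosDesign) (Ψ : Env) (q : Chronicle) : Prop :=
  q = [] ∨ ∃ q' ξ, ∃ I : Finset ℕ, ∃ i ∈ I, ∃ J,
    q = q' ++ [Move.pos ξ I, Move.neg (ξ.child i) J] ∧ Eval φ Ψ (q' ++ [Move.pos ξ I])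

/-- The latest (S) step crossed an uncut action, which was then produced. `Live` mentions only
`Eval`, which makes reachability of an index transferable to intersections. -/
theorem Reached.live {φ : PosDesign} {Ψ : Env} {s : State} (h : Reached φ Ψ s) :
    Live φ Ψ s.index := by
  induction h with
  | refl => exact Or.inl rfl
  | @tail s t hs h ih =>
    rcases h with h | ⟨ξ, I, f, hc, hξ, i, J, rfl⟩
    · rwa [h.index_eq]
    · refine Or.inr ⟨s.index, ξ, I, i, i.2, J, rfl, ?_⟩
      rw [Reached.eval_iff hs, hc]
      exact Eval.uncut hξ

theorem Eval.exists_reflTransGen {φ : PosDesign} {Ψ : Env} {r : Chronicle} (h : Eval φ Ψ r)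
    (q : Chronicle) : ∃ s : State, Relation.ReflTransGen Step ⟨φ, Ψ, q⟩ s ∧
      ((s.code = PosDesign.daimon ∧ q ++ r = s.index ++ [Move.daimon]) ∨
        ∃ ξ I f, s.code = PosDesign.act ξ I f ∧ s.env ξ = none ∧
          q ++ r = s.index ++ [Move.pos ξ I]) := by
  induction h generalizing q with
  | daimon Ψ => exact ⟨_, .refl, Or.inl ⟨rfl, rfl⟩⟩
  | uncut h => exact ⟨_, .refl, Or.inr ⟨_, _, _, rfl, h, rfl⟩⟩
  | cut h _ ih =>
    obtain ⟨s, hs, h'⟩ := ih q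
    exact ⟨s, .head (Or.inl ⟨_, _, _, _, rfl, h, rfl⟩) hs, h'⟩
  | @explore ξ I f Ψ i J r h _ ih =>
    obtain ⟨s, hs, h'⟩ := ih (q ++ [Move.pos ξ I, Move.neg (ξ.child i) J])
    refine ⟨s, .head (Or.inr ⟨_, _, _, rfl, h, i, J, rfl⟩) hs, ?_⟩
    simpa using h'

theorem Live.exists_reached {φ : PosDesign} {Ψ : Env} {q : Chronicle} (h : Live φ Ψ q) :
    ∃ s, Reached φ Ψ s ∧ s.index = q := by
  rcases h with rfl | ⟨q', ξ, I, i, hi, J, rfl, h⟩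
  · exact ⟨_, .refl, rfl⟩
  · obtain ⟨s, hs, ⟨-, h⟩ | ⟨ξ', I', f, hc, hξ, h⟩⟩ := h.exists_reflTransGen []
    · have := (List.append_inj' (show q' ++ _ = _ from h) rfl).2
      simp at this
    · obtain ⟨h1, h2⟩ := List.append_inj' (show q' ++ _ = _ from h) rfl
      simp only [List.cons.injEq, Move.pos.injEq, and_true] at h2
      obtain ⟨rfl, rfl⟩ := h2
      obtain rfl : q' = s.index := h1
      exact ⟨_, .tail hs (Or.inr ⟨ξ, I, f, hc, hξ, ⟨i, hi⟩, J, rfl⟩), rfl⟩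

/-- Since (R) is deterministic, an infinite sequence of (R) steps would have to follow the finite
derivation. -/
theorem Eval.not_forall_rStep {φ : PosDesign} {Ψ : Env} {r : Chronicle} (h : Eval φ Ψ r)
    (s : ℕ → State) (h0 : (s 0).code = φ) (h0' : (s 0).env = Ψ) :
    ¬ ∀ n, RStep (s n) (s (n + 1)) := by
  intro hs
  induction h generalizing s with
  | daimon =>
    obtain ⟨ξ, I, f, g, hc, -, -⟩ := hs 0
    exact PosDesign.daimon_ne_act _ _ _ (h0.symm.trans hc)
  | uncut h =>
    obtain ⟨ξ, I, f, g, hc, hg, -⟩ := hs 0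
    obtain ⟨rfl, rfl, -⟩ := PosDesign.act_inj (h0.symm.trans hc)
    simp [h0', h] at hg
  | cut h _ ih =>
    obtain ⟨ξ, I, f, g, hc, hg, h1⟩ := hs 0
    obtain ⟨rfl, rfl, hf⟩ := PosDesign.act_inj (h0.symm.trans hc)
    obtain rfl := eq_of_heq hf
    rw [h0', h] at hg
    obtain rfl := Option.some.inj hg
    exact ih (fun n => s (n + 1)) (by rw [h1]) (by rw [h1, h0']) fun n => hs (n + 1)
  | explore h =>
    obtain ⟨ξ, I, f, g, hc, hg, -⟩ := hs 0
    obtain ⟨rfl, rfl, -⟩ := PosDesign.act_inj (h0.symm.trans hc)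
    simp [h0', h] at hg

theorem append_omega_mem_normalForm {φ : PosDesign} {Ψ : Env} {q : Chronicle} (hq : Live φ Ψ q)
    (h : ∀ r, ¬ Eval φ Ψ (q ++ r)) : q ++ [Move.omega] ∈ normalForm φ Ψ := by
  obtain ⟨s, hs, rfl⟩ := hq.exists_reached
  by_cases hΩ : ∃ t, Reached φ Ψ t ∧ t.index = s.index ∧ t.code = PosDesign.omega
  · obtain ⟨t, ht, hi, hc⟩ := hΩ
    exact Or.inl (Or.inl (Or.inr ⟨t, ht, hc, by rw [hi]⟩))
  -- A daimon or an uncut action at this index would yield a chronicle extending it. Only cut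
  -- actions remain, and iterating the (R) step gives the infinite sequence.
  · have key : ∀ t : {t // Reached φ Ψ t ∧ t.index = s.index},
        ∃ u : {t // Reached φ Ψ t ∧ t.index = s.index}, RStep t.1 u.1 := by
      rintro ⟨t, ht, hi⟩
      have hE : ∀ r, ¬ Eval t.code t.env r := fun r => by
        rw [← ht.eval_iff, hi]
        exact h r
      rcases PosDesign.exists_form t.code with hc | hc | ⟨ξ, I, f, hc⟩
      · exact (hΩ ⟨t, ht, hi, hc⟩).elim
      · exact (hE _ (hc ▸ Eval.daimon _)).elim
      · cases hξ : t.env ξ with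
        | none => exact (hE _ (hc ▸ Eval.uncut hξ)).elim
        | some g =>
          have hR : RStep t ⟨g I, t.env.consume ξ I f, t.index⟩ := ⟨ξ, I, f, g, hc, hξ, rfl⟩
          exact ⟨⟨_, .tail ht (Or.inl hR), hi⟩, hR⟩
    choose F hF using key
    refine Or.inr ⟨fun n => (F^[n] ⟨s, hs, rfl⟩).1, hs, fun n => ?_, rfl⟩
    simp only [Function.iterate_succ_apply']
    exact hF _

theorem mem_normalForm {φ : PosDesign} {Ψ : Env} {r : Chronicle} :
    r ∈ normalForm φ Ψ ↔ Eval φ Ψ r ∨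
      ∃ q, r = q ++ [Move.omega] ∧ Live φ Ψ q ∧ ∀ r', ¬ Eval φ Ψ (q ++ r') := by
  constructor
  · rintro (((⟨s, ξ, I, f, hs, hc, hξ, rfl⟩ | ⟨s, hs, hc, rfl⟩) | ⟨s, hs, hc, rfl⟩) |
      ⟨s, hs, h, rfl⟩)
    · left
      rw [hs.eval_iff, hc]
      exact Eval.uncut hξ
    · refine Or.inr ⟨_, rfl, hs.live, fun r' h => ?_⟩
      rw [hs.eval_iff, hc] at h
      exact Eval.not_omega h
    · left
      rw [hs.eval_iff, hc]
      exact Eval.daimon _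
    · exact Or.inr ⟨_, rfl, hs.live, fun r' h' =>
        (hs.eval_iff.1 h').not_forall_rStep s rfl rfl h⟩
  · rintro (h | ⟨q, rfl, hq, h⟩)
    · obtain ⟨s, hs, ⟨hc, h⟩ | ⟨ξ', I', f, hc, hξ, h⟩⟩ := h.exists_reflTransGen []
      · exact Or.inl (Or.inr ⟨s, hs, hc, h⟩)
      · exact Or.inl (Or.inl (Or.inl ⟨s, _, _, f, hs, hc, hξ, h⟩))
    · exact append_omega_mem_normalForm hq h

theorem Eval.getLast?_ne {φ : PosDesign} {Ψ : Env} {r : Chronicle} (h : Eval φ Ψ r) :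
    r.getLast? ≠ some Move.omega := by
  obtain ⟨s, hs, ⟨-, h⟩ | ⟨ξ', I', f, -, -, h⟩⟩ := h.exists_reflTransGen []
  · obtain rfl : r = _ := h
    simp
  · obtain rfl : r = _ := h
    simp

theorem mem_nfChronicles {φ : PosDesign} {ψ : NegDesign} {r : Chronicle} :
    r ∈ nfChronicles φ ψ ↔ Eval φ (Env.single ψ) r := by
  constructor
  · rintro ⟨h, hr⟩
    rcases mem_normalForm.1 h with h | ⟨q, rfl, -⟩
    · exact h
    · simp at hr
  · exact fun h => ⟨mem_normalForm.2 (Or.inl h), h.getLast?_ne⟩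

theorem orthogonal_iff {φ : PosDesign} {ψ : NegDesign} :
    Orthogonal φ ψ ↔ [Move.daimon] ∈ nfChronicles φ ψ := by
  constructor
  · intro h
    refine ⟨?_, by simp⟩
    rw [h]
    rfl
  · intro h
    refine Set.Subset.antisymm (fun r hr => ?_) (Set.singleton_subset_iff.2 h.1)
    rw [mem_nfChronicles] at h
    rcases mem_normalForm.1 hr with hr | ⟨q, rfl, rfl | ⟨q', ξ, I, i, hi, J, rfl, hq⟩, hr⟩
    · exact h.eq_daimon hr
    · exact (hr _ h).elim
    · have := h.eq_daimon hq
      -- A nonempty live index would give a second chronicle, ending with a proper action, next to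
      -- `✠`.
      cases q' <;> simp at this

/-! ### Stability -/

namespace NegDesign

/-- `ψ` is the intersection of the designs `ψs k`, which have the same focus. -/
def IsInter {ι : Sort*} (ψ : NegDesign) (ψs : ι → NegDesign) : Prop :=
  (∀ k, (ψs k).focus = ψ.focus) ∧ ∀ J, PosDesign.IsInter (ψ.branch J) fun k => (ψs k).branch J

theorem cons_mem_chronicles {ψ : NegDesign} {J : Finset ℕ} {r : Chronicle} :
    Move.neg ψ.focus J :: r ∈ ψ.chronicles ↔ r ∈ (ψ.branch J).chronicles := by
  constructor
  · rintro ⟨J', r', h, e⟩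
    simp only [List.cons.injEq, Move.neg.injEq, true_and] at e
    obtain ⟨rfl, rfl⟩ := e
    exact h
  · exact fun h => ⟨J, r, h, rfl⟩

theorem isInter_iff {ι : Sort*} [Nonempty ι] {ψ : NegDesign} {ψs : ι → NegDesign}
    (hfocus : ∀ k, (ψs k).focus = ψ.focus) :
    ψ.IsInter ψs ↔ ψ.chronicles = ⋂ k, (ψs k).chronicles := by
  constructor
  · rintro ⟨-, h⟩
    ext r
    rw [Set.mem_iInter]
    constructor
    · rintro ⟨J, r, hr, rfl⟩ k
      rw [← hfocus k, cons_mem_chronicles]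
      exact PosDesign.sub_iff_chronicles_subset.1 ((h J).sub k) hr
    · intro hr
      obtain ⟨J, r, -, rfl⟩ := hr (Classical.arbitrary ι)
      rw [hfocus, cons_mem_chronicles, h J, Set.mem_iInter]
      intro k
      rw [← cons_mem_chronicles, hfocus, ← hfocus (Classical.arbitrary ι)]
      exact hr k
  · refine fun h => ⟨hfocus, fun J => Set.ext fun r => ?_⟩
    rw [← cons_mem_chronicles, h, Set.mem_iInter, Set.mem_iInter]
    exact forall_congr' fun k => by rw [← hfocus k, cons_mem_chronicles]

theorem IsInter.sub {ι : Sort*} {ψ : NegDesign} {ψs : ι → NegDesign} (h : ψ.IsInter ψs) (k : ι) :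
    ψ ⊆ ψs k :=
  ⟨(h.1 k).symm, fun J => (h.2 J).sub k⟩

theorem sub_trans {a b c : NegDesign} (hab : a ⊆ b) (hbc : b ⊆ c) : a ⊆ c :=
  ⟨hab.1.trans hbc.1, fun J => PosDesign.sub_trans (hab.2 J) (hbc.2 J)⟩

theorem exists_isInter {ι : Sort*} [Nonempty ι] {ζ : Address} {ψs : ι → NegDesign}
    (hfocus : ∀ k, (ψs k).focus = ζ) : ∃ ψ : NegDesign, ψ.IsInter ψs ∧ ψ.focus = ζ :=
  ⟨⟨ζ, fun J => PosDesign.inter (Set.range fun k => (ψs k).branch J)⟩,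
    ⟨hfocus, fun _ => PosDesign.isInter_inter_range _⟩, rfl⟩

end NegDesign

section

variable {ι : Sort*} [Nonempty ι] {φ φ₀ : PosDesign} {ψ ψ₀ : NegDesign} {φs : ι → PosDesign}
  {ψs : ι → NegDesign}

/-- Normalization commutes with bounded intersections. -/
theorem nfChronicles_eq_iInter (hφ : ∀ k, φs k ⊆ φ) (hψ : ∀ k, ψs k ⊆ ψ)
    (hφ₀ : φ₀.IsInter φs) (hψ₀ : ψ₀.IsInter ψs) :
    nfChronicles φ₀ ψ₀ = ⋂ k, nfChronicles (φs k) (ψs k) := by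
  ext r
  simp only [Set.mem_iInter, mem_nfChronicles]
  exact ⟨fun h k => h.mono (hφ₀.sub k) (Env.Sub.single (hψ₀.sub k)),
    Eval.of_isInter (k₀ := Classical.arbitrary ι) hφ₀ (Env.IsInter.single hψ₀.1 hψ₀.2) hφ
      fun k => Env.Sub.single (hψ k)⟩

theorem mem_nf_of_isInter (hφ : ∀ k, φs k ⊆ φ) (hψ : ∀ k, ψs k ⊆ ψ)
    (hφ₀ : φ₀.IsInter φs) (hψ₀ : ψ₀.IsInter ψs) {r : Chronicle}
    (hr : ∀ k, r ∈ nf (φs k) (ψs k)) : r ∈ nf φ₀ ψ₀ := by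
  have hE : ∀ r, Eval φ₀ (Env.single ψ₀) r ↔ ∀ k, Eval (φs k) (Env.single (ψs k)) r := by
    intro r
    have := Set.ext_iff.1 (nfChronicles_eq_iInter hφ hψ hφ₀ hψ₀) r
    simpa only [Set.mem_iInter, mem_nfChronicles] using this
  by_cases hΩ : r.getLast? = some Move.omega
  · have hr' : ∀ k, ∃ q, r = q ++ [Move.omega] ∧ Live (φs k) (Env.single (ψs k)) q ∧
        ∀ r', ¬ Eval (φs k) (Env.single (ψs k)) (q ++ r') := by
      intro k
      rcases mem_normalForm.1 (hr k) with h | h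
      · exact (h.getLast?_ne hΩ).elim
      · exact h
    obtain ⟨q, rfl, hq, hn⟩ := hr' (Classical.arbitrary ι)
    -- Failure to evaluate at one index is enough for the intersection; liveness needs all of them,
    -- and `q` fixes the same `q'`, `ξ`, `I` for each.
    refine append_omega_mem_normalForm ?_ fun r' h => hn r' ((hE _).1 h _)
    rcases hq with rfl | ⟨q', ξ, I, i, hi, J, rfl, -⟩
    · exact Or.inl rfl
    · refine Or.inr ⟨q', ξ, I, i, hi, J, rfl, (hE _).2 fun k => ?_⟩
      obtain ⟨q, h1, h2, -⟩ := hr' k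
      obtain rfl := List.append_cancel_right h1
      rcases h2 with h2 | ⟨q₂, ξ₂, I₂, i₂, -, J₂, h2, h3⟩
      · simp at h2
      · obtain ⟨rfl, h4⟩ := List.append_inj' h2 rfl
        simp only [List.cons.injEq, Move.pos.injEq] at h4
        obtain ⟨⟨rfl, rfl⟩, -⟩ := h4
        exact h3
  · exact (mem_nfChronicles.2 ((hE r).2 fun k => mem_nfChronicles.1 ⟨hr k, hΩ⟩)).1

end

theorem nf_omega {ψ : NegDesign} {r : Chronicle} (h : r ∈ nf PosDesign.omega ψ) :
    r = [Move.omega] := by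
  rcases mem_normalForm.1 h with h | ⟨q, rfl, rfl | ⟨_, _, _, _, _, _, _, h⟩, -⟩
  · exact (Eval.not_omega h).elim
  · rfl
  · exact (Eval.not_omega h).elim

theorem PosDesign.IsInter.ne_omega {ι : Sort*} [Nonempty ι] {a b : PosDesign}
    {as : ι → PosDesign} (h : IsInter a as) (hb : ∀ k, as k ⊆ b) (hne : ∀ k, as k ≠ omega) :
    a ≠ omega := by
  rcases exists_form (as (Classical.arbitrary ι)) with h₀ | h₀ | ⟨ξ, I, f, h₀⟩
  · exact (hne _ h₀).elim
  · rw [h.eq_daimon (forall_eq_daimon_of_sub hb hne h₀)]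
    exact omega_ne_daimon.symm
  · obtain ⟨fs, g, has, -, -⟩ := exists_forall_eq_act_of_sub hb hne h₀
    obtain ⟨f, rfl, -⟩ := h.exists_eq_act has
    exact (omega_ne_act _ _ _).symm

end Ludics

theorem mainTheorem5 (ξ : Address) (Λ₁ Λ₂ : Finset Address)
    (hΛ : ∀ a ∈ Λ₁, ∀ b ∈ Λ₂, Address.Apart a b)
    (φ : PosDesign) (ψ : NegDesign)
    (hφ : φ.HasBase (insert ξ Λ₁)) (hψ : ψ.HasBase ξ Λ₂) :
    -- every chronicle of the normal form has a pull-back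
    (∀ r ∈ nf φ ψ, ∃ (φ₀ : PosDesign) (ψ₀ : NegDesign),
      φ₀.HasBase (insert ξ Λ₁) ∧ ψ₀.HasBase ξ Λ₂ ∧ (r ≠ [Move.omega] → φ₀ ≠ PosDesign.omega) ∧
      φ₀ ⊆ φ ∧ ψ₀ ⊆ ψ ∧ r ∈ nf φ₀ ψ₀ ∧
      ∀ (φ' : PosDesign) (ψ' : NegDesign), φ' ⊆ φ → ψ' ⊆ ψ → r ∈ nf φ' ψ' →
        φ₀ ⊆ φ' ∧ ψ₀ ⊆ ψ') ∧
    -- normalization commutes with bounded intersections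
    (∀ (ι : Type*) [Nonempty ι] (φs : ι → PosDesign) (ψs : ι → NegDesign),
      (∀ k, φs k ⊆ φ) → (∀ k, ψs k ⊆ ψ) →
      -- the intersections are designs
      (∃ φi : PosDesign, φi.HasBase (insert ξ Λ₁) ∧ φi.chronicles = ⋂ k, (φs k).chronicles ∧
        ((∀ k, φs k ≠ PosDesign.omega) → φi ≠ PosDesign.omega)) ∧
      (∃ ψi : NegDesign, ψi.HasBase ξ Λ₂ ∧ ψi.chronicles = ⋂ k, (ψs k).chronicles) ∧
      -- and their normal form is the intersection of the normal forms
      ∀ (φi : PosDesign) (ψi : NegDesign), φi.chronicles = ⋂ k, (φs k).chronicles →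
        ψi.focus = ξ → ψi.chronicles = ⋂ k, (ψs k).chronicles →
        nfChronicles φi ψi = ⋂ k, nfChronicles (φs k) (ψs k) ∧
        (Λ₁ = ∅ → Λ₂ = ∅ → (Orthogonal φi ψi ↔ ∀ k, Orthogonal (φs k) (ψs k)))) := by
  refine ⟨fun r hr => ?_, fun ι _ φs ψs hφs hψs => ⟨?_, ?_, fun φi ψi hφi hfoc hψi => ?_⟩⟩
  -- All competitors for the minimum, `(φ, ψ)` among them; their intersection is itself a
  -- competitor.
  · let K := {p : PosDesign × NegDesign // p.1 ⊆ φ ∧ p.2 ⊆ ψ ∧ r ∈ nf p.1 p.2}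
    have : Nonempty K :=
      ⟨⟨(φ, ψ), PosDesign.sub_refl, ⟨rfl, fun _ => PosDesign.sub_refl⟩, hr⟩⟩
    have hφ₀ := PosDesign.isInter_inter_range fun k : K => k.1.1
    obtain ⟨ψ₀, hψ₀, -⟩ := NegDesign.exists_isInter (ψs := fun k : K => k.1.2) (ζ := ξ)
      fun k => k.2.2.1.1.trans hψ.1
    have k₀ : K := Classical.arbitrary K
    have hle := PosDesign.sub_trans (hφ₀.sub k₀) k₀.2.1
    have hle' := NegDesign.sub_trans (hψ₀.sub k₀) k₀.2.2.1
    have hmem := mem_nf_of_isInter (fun k : K => k.2.1) (fun k : K => k.2.2.1) hφ₀ hψ₀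
      fun k : K => k.2.2.2
    exact ⟨_, ψ₀, hφ.mono hle, hψ.mono hle', fun h h' => h (nf_omega (h' ▸ hmem)), hle, hle',
      hmem, fun φ' ψ' h1 h2 h3 =>
        ⟨hφ₀.sub ⟨(φ', ψ'), h1, h2, h3⟩, hψ₀.sub ⟨(φ', ψ'), h1, h2, h3⟩⟩⟩
  · have h := PosDesign.isInter_inter_range φs
    exact ⟨_, hφ.mono (PosDesign.sub_trans (h.sub (Classical.arbitrary ι)) (hφs _)), h, h.ne_omega hφs⟩
  · obtain ⟨ψ₀, hψ₀, -⟩ := NegDesign.exists_isInter fun k => (hψs k).1.trans hψ.1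
    exact ⟨ψ₀, hψ.mono (NegDesign.sub_trans (hψ₀.sub (Classical.arbitrary ι)) (hψs _)),
      (NegDesign.isInter_iff hψ₀.1).1 hψ₀⟩
  · have h := nfChronicles_eq_iInter hφs hψs hφi
      ((NegDesign.isInter_iff fun k => ((hψs k).1.trans hψ.1).trans hfoc.symm).2 hψi)
    refine ⟨h, fun _ _ => ?_⟩
    -- Orthogonality is membership of the single chronicle `✠`, so it commutes with the
    -- intersection.
    simp only [orthogonal_iff, h, Set.mem_iInter]
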